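/- Let $g\ge 1$, let $\pi_g=\langle a_1,b_1,\dots,a_g,b_g\mid \prod_{i=1}^g[a_i,b_i]\rangle$ be the surface group, and let $F_g$ be the free group with free generators $\gamma_1,\dots,\gamma_g$. Identify the mapping class group $\mathrm{Mod}_g$ of a closed oriented surface of genus $g$ with $\mathrm{Out}^+(\pi_g)=\mathrm{Aut}^+(\pi_g)/\mathrm{Inn}(\pi_g)$ (Dehn--Nielsen--Baer), where $\mathrm{Aut}^+(\pi_g)$ is the group of orientation preserving automorphisms of $\pi_g$, i.e. those acting trivially on $H_2(\pi_g;\mathbb Z)$. Let $(a_1,b_1,\dots,a_g,b_g)$ be any set of symplectic generators of $\pi_g$ (generators of $\pi_g$ for which $\prod_{i=1}^g[a_i,b_i]=1$ is a defining relation), and for $x\in\pi_g$ let $\sharp_{a_i}(x)$, $\sharp_{b_i}(x)$ be the sums of the exponents of $a_i$, respectively $b_i$, in a word in these generators that represents $x$; these exponent sums induce the identification $H_1=\pi_g^{\mathrm{ab}}\cong\mathbb Z^{2g}$. Let $\alpha\colon\pi_g\to F_g$ be the homomorphism with $\alpha(a_i)=1$ and $\alpha(b_i)=\gamma_i$ for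 $1\le i\le g$, and let $$\mathrm{Mod}_g(\alpha)=\{[\tilde\varphi]\in\mathrm{Mod}_g \mid \tilde\varphi\in\mathrm{Aut}^+(\pi_g),\ \exists c\in F_g\ \forall x\in\pi_g:\ \alpha(\tilde\varphi(x))=c\,\alpha(x)\,c^{-1}\}.$$ Let $\varphi\in\mathrm{Mod}_g(\alpha)$. Then for every $\tilde\varphi\in\mathrm{Aut}^+(\pi_g)$ that represents $\varphi$ and all $i,j\in\{1,\dots,g\}$: (a) $\sharp_{b_i}(\tilde\varphi(b_j))=\delta_{ij}$; (b) $\sharp_{b_i}(\tilde\varphi(a_j))=0$; (c) $\sharp_{a_j}(\tilde\varphi(a_i))=\delta_{ij}$. (d) Let $M_\varphi\in\mathbb Z^{2g\times 2g}$ be the matrix with entries $\sharp_s(\tilde\varphi(t))$, where the row index $s$ and the column index $t$ run through $a_1,\dots,a_g,b_1,\dots,b_g$ in this order. Then $M_\varphi$ is the matrix of the action of $\varphi$ on $H_1\cong\mathbb Z^{2g}$, and $$M_\varphi=\begin{pmatrix} I_g & A\\ 0 & I_g\end{pmatrix}\quad\text{for some } A\in\mathbb Z^{g\times g}.$$ In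 particular, $1$ is the only (complex) eigenvalue of $M_\varphi$, its algebraic multiplicity is $2g$, and $\det M_\varphi=1$. -/

import Mathlib

noncomputable section

/-- The word `[a₁,b₁]⋯[a_g,b_g]` in the free group on `a₁,…,a_g` (indices `Sum.inl i`) and
`b₁,…,b_g` (indices `Sum.inr i`). -/
def surfaceRelator (g : ℕ) : FreeGroup (Fin g ⊕ Fin g) :=
  (List.ofFn fun i : Fin g =>
    FreeGroup.of (Sum.inl i) * FreeGroup.of (Sum.inr i) *
      (FreeGroup.of (Sum.inl i))⁻¹ * (FreeGroup.of (Sum.inr i))⁻¹).prod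

/-- The surface group `π_g = ⟨a₁,b₁,…,a_g,b_g ∣ [a₁,b₁]⋯[a_g,b_g]⟩`. -/
abbrev SurfaceGroup (g : ℕ) : Type := PresentedGroup {surfaceRelator g}

namespace SurfaceGroup

open CategoryTheory

/-! ### The mapping class group `Mod_g = Out⁺(π_g)` -/

/-- The map induced by an automorphism of `π_g` on the group homology `H₂(π_g; ℤ)`
(an infinite cyclic group, generated by the fundamental class of the surface, for `g ≥ 1`). -/
def H2Map {g : ℕ} (f : MulAut (SurfaceGroup g)) :
    groupHomology (Rep.trivial ℤ (SurfaceGroup g) ℤ) 2 ⟶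
      groupHomology (Rep.trivial ℤ (SurfaceGroup g) ℤ) 2 :=
  groupHomology.map f.toMonoidHom (𝟙 (Rep.trivial ℤ (SurfaceGroup g) ℤ)) 2

theorem H2Map_one {g : ℕ} : H2Map (1 : MulAut (SurfaceGroup g)) = 𝟙 _ :=
  groupHomology.map_id 2

theorem H2Map_mul {g : ℕ} (f₁ f₂ : MulAut (SurfaceGroup g)) :
    H2Map (f₁ * f₂) = H2Map f₂ ≫ H2Map f₁ :=
  groupHomology.map_comp (A := Rep.trivial ℤ (SurfaceGroup g) ℤ)
    (B := Rep.trivial ℤ (SurfaceGroup g) ℤ) (C := Rep.trivial ℤ (SurfaceGroup g) ℤ)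
    f₂.toMonoidHom f₁.toMonoidHom (𝟙 _) (𝟙 _) 2

/-- `Aut⁺(π_g)`: the orientation preserving automorphisms of `π_g`, i.e. those that act
trivially on `H₂(π_g; ℤ)`. -/
def autPlus (g : ℕ) : Subgroup (MulAut (SurfaceGroup g)) where
  carrier := {f | H2Map f = 𝟙 _}
  one_mem' := H2Map_one
  mul_mem' {f₁ f₂} h₁ h₂ := by
    simp only [Set.mem_ofPred_eq] at *
    rw [H2Map_mul, h₁, h₂, Category.comp_id]
  inv_mem' {f} h := by
    simp only [Set.mem_ofPred_eq] at *
    have := H2Map_mul f f⁻¹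
    rw [mul_inv_cancel, H2Map_one, h, Category.comp_id] at this
    exact this.symm

/-- `Inn(π_g)` -/
abbrev inner (g : ℕ) : Subgroup (MulAut (SurfaceGroup g)) := MulAut.conj.range

instance inner_normal (g : ℕ) : (inner g).Normal where
  conj_mem := by
    rintro _ ⟨x, rfl⟩ f
    refine ⟨f x, ?_⟩
    ext y
    simp [MulAut.conj_apply]

/-- The mapping class group `Mod_g`, as the group `Out⁺(π_g) = Aut⁺(π_g) / Inn(π_g)` of
orientation preserving outer automorphisms of `π_g`. -/
abbrev MappingClassGroup (g : ℕ) : Type := autPlus g ⧸ (inner g).subgroupOf (autPlus g)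

/-- The class in `Mod_g = Out⁺(π_g)` of an element of `Aut⁺(π_g)`. -/
abbrev outerClass {g : ℕ} (f : autPlus g) : MappingClassGroup g := QuotientGroup.mk f

/-- `Mod_g(α)`: the classes of those `f ∈ Aut⁺(π_g)` for which `α ∘ f` agrees with `α` up to an
inner automorphism of `F_g`. -/
def modSubgroup {g : ℕ} (α : SurfaceGroup g →* FreeGroup (Fin g)) :
    Subgroup (MappingClassGroup g) where
  carrier := {φ | ∃ f : autPlus g, outerClass f = φ ∧
    ∃ c : FreeGroup (Fin g), ∀ x, α (f.1 x) = c * α x * c⁻¹}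
  one_mem' := ⟨1, rfl, 1, fun x => by simp⟩
  mul_mem' := by
    rintro _ _ ⟨f₁, rfl, c₁, h₁⟩ ⟨f₂, rfl, c₂, h₂⟩
    refine ⟨f₁ * f₂, rfl, c₁ * c₂, fun x => ?_⟩
    have : (f₁ * f₂).1 x = f₁.1 (f₂.1 x) := rfl
    rw [this, h₁, h₂]
    group
  inv_mem' := by
    rintro _ ⟨f, rfl, c, h⟩
    refine ⟨f⁻¹, rfl, c⁻¹, fun x => ?_⟩
    have := h ((f⁻¹).1 x)
    have hx : f.1 ((f⁻¹).1 x) = x := f.1.apply_symm_apply x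
    rw [hx] at this
    rw [this]
    group

/-! ### Symplectic generators and exponent sums -/

/-- A set of symplectic generators `(a₁,b₁,…,a_g,b_g)` of `π_g`: elements that satisfy
`[a₁,b₁]⋯[a_g,b_g] = 1` and such that `π_g` is presented by these generators with this relation.
`gen` is `a_i` at the index `Sum.inl i`, and `b_i` at the index `Sum.inr i`. -/
structure SymplecticGenerators (g : ℕ) where
  gen : Fin g ⊕ Fin g → SurfaceGroup g
  relation : ∀ r ∈ ({surfaceRelator g} : Set (FreeGroup (Fin g ⊕ Fin g))), FreeGroup.lift gen r = 1
  presentation : Function.Bijective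
    (PresentedGroup.toGroup relation : SurfaceGroup g →* SurfaceGroup g)

/-- The exponent sum of a letter in a word in the standard generators of `π_g`. -/
def stdExpSum {g : ℕ} (s : Fin g ⊕ Fin g) : SurfaceGroup g →* Multiplicative ℤ :=
  PresentedGroup.toGroup (f := fun t => Multiplicative.ofAdd (if s = t then (1 : ℤ) else 0)) (by
    intro r hr
    rw [Set.mem_singleton_iff.mp hr, surfaceRelator, map_list_prod, List.map_ofFn]
    refine List.prod_eq_one ?_
    intro x hx
    obtain ⟨i, rfl⟩ := (List.mem_ofFn' _ _).mp hx
    simp [mul_inv_cancel_comm])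

namespace SymplecticGenerators

variable {g : ℕ} (S : SymplecticGenerators g)

/-- The automorphism of `π_g` that maps the standard generators to the generators `S`. -/
def ofStandard : SurfaceGroup g ≃* SurfaceGroup g :=
  MulEquiv.ofBijective (PresentedGroup.toGroup S.relation) S.presentation

theorem ofStandard_of (s : Fin g ⊕ Fin g) : S.ofStandard (PresentedGroup.of s) = S.gen s :=
  PresentedGroup.toGroup.of S.relation

/-- The generator `a_i`. -/
def a (i : Fin g) : SurfaceGroup g := S.gen (Sum.inl i)

/-- The generator `b_i`. -/
def b (i : Fin g) : SurfaceGroup g := S.gen (Sum.inr i)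

/-- `♯_s`: the exponent sum of the generator with index `s` in a word in the generators `S`,
as a homomorphism on `π_g`. -/
def expSumHom (s : Fin g ⊕ Fin g) : SurfaceGroup g →* Multiplicative ℤ :=
  (stdExpSum s).comp S.ofStandard.symm.toMonoidHom

/-- `♯_s(x)`: the exponent sum of the generator with index `s` in `x`. -/
def expSum (s : Fin g ⊕ Fin g) (x : SurfaceGroup g) : ℤ := (S.expSumHom s x).toAdd

/-- `♯_{a_i}(x)` -/
def expSumA (i : Fin g) (x : SurfaceGroup g) : ℤ := S.expSum (Sum.inl i) x

/-- `♯_{b_i}(x)` -/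
def expSumB (i : Fin g) (x : SurfaceGroup g) : ℤ := S.expSum (Sum.inr i) x

theorem expSumHom_gen (s t : Fin g ⊕ Fin g) :
    S.expSumHom s (S.gen t) = Multiplicative.ofAdd (if s = t then (1 : ℤ) else 0) := by
  rw [← S.ofStandard_of]
  simp [expSumHom, stdExpSum]

end SymplecticGenerators

/-! ### The action on `H₁ = π_g^{ab} ≅ ℤ^{2g}` and its matrix -/

/-- `H₁ = π_g^{ab}`, the abelianized surface group. -/
abbrev H1 (g : ℕ) : Type := Abelianization (SurfaceGroup g)

/-- The action of `Mod_g = Out⁺(π_g)` on `H₁ = π_g^{ab}`. -/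
def H1Action (g : ℕ) : MappingClassGroup g →* MulAut (H1 g) :=
  QuotientGroup.lift _
    { toFun := fun f => f.1.abelianizationCongr
      map_one' := by ext x; induction x using QuotientGroup.induction_on; rfl
      map_mul' := fun f₁ f₂ => by ext x; induction x using QuotientGroup.induction_on; rfl }
    (by
      rintro f ⟨x, hx⟩
      ext y
      induction y using QuotientGroup.induction_on with
      | H y =>
        change Abelianization.of (f.1 y) = Abelianization.of y
        have : f.1 = MulAut.conj x := hx.symm
        rw [this, MulAut.conj_apply, map_mul, map_mul, map_inv, mul_inv_cancel_comm])

namespace SymplecticGenerators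

variable {g : ℕ} (S : SymplecticGenerators g)

/-- The vector of exponent sums of an element of `H₁`. -/
def coordHom : H1 g →* Multiplicative (Fin g ⊕ Fin g → ℤ) :=
  Abelianization.lift
    { toFun := fun x => Multiplicative.ofAdd fun s => S.expSum s x
      map_one' := by ext s; simp [expSum]
      map_mul' := fun x y => by ext s; simp [expSum] }

/-- The identification `H₁ = π_g^{ab} ≅ ℤ^{2g}` given by the exponent sums with respect to the
symplectic generators `S`. -/
def H1Equiv : H1 g ≃* Multiplicative (Fin g ⊕ Fin g → ℤ) :=
  MulEquiv.ofBijective S.coordHom (by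
    let inv : Multiplicative (Fin g ⊕ Fin g → ℤ) →* H1 g :=
      { toFun := fun v => ∏ s, Abelianization.of (S.gen s) ^ (v.toAdd s)
        map_one' := by simp
        map_mul' := fun v w => by simp [zpow_add, Finset.prod_mul_distrib] }
    have h1 : ∀ s, S.coordHom (Abelianization.of (S.gen s)) =
        Multiplicative.ofAdd (Pi.single s 1) := by
      intro s
      ext t
      simp [coordHom, expSum, expSumHom_gen, Pi.single_apply]
    have hinv : ∀ s, inv (Multiplicative.ofAdd (Pi.single s 1)) =
        Abelianization.of (S.gen s) := by
      intro s
      change ∏ t, Abelianization.of (S.gen t) ^ ((Pi.single s 1 : Fin g ⊕ Fin g → ℤ) t) = _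
      rw [Finset.prod_eq_single s]
      · simp
      · intro t _ ht
        simp [ht]
      · simp
    have hleft : inv.comp S.coordHom = MonoidHom.id _ := by
      have : ((inv.comp S.coordHom).comp Abelianization.of).comp S.ofStandard.toMonoidHom =
          (Abelianization.of).comp S.ofStandard.toMonoidHom := by
        apply PresentedGroup.ext
        intro s
        change inv (S.coordHom (Abelianization.of (S.ofStandard (PresentedGroup.of s)))) =
          Abelianization.of (S.ofStandard (PresentedGroup.of s))
        rw [S.ofStandard_of]
        rw [h1, hinv]
      refine Abelianization.hom_ext _ _ (MonoidHom.ext fun x => ?_)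
      have hx := DFunLike.congr_fun this (S.ofStandard.symm x)
      simpa using hx
    constructor
    · exact Function.LeftInverse.injective (g := inv) (fun x => DFunLike.congr_fun hleft x)
    · apply Function.RightInverse.surjective (g := inv)
      intro v
      change S.coordHom (∏ s, Abelianization.of (S.gen s) ^ (v.toAdd s)) = v
      rw [map_prod]
      simp only [map_zpow, h1]
      apply Multiplicative.toAdd.injective
      rw [toAdd_prod]
      ext t
      simp [Pi.single_apply])

/-- The coordinate vector in `ℤ^{2g}` of an element of `H₁`. -/
def coord (x : H1 g) : Fin g ⊕ Fin g → ℤ := (S.H1Equiv x).toAdd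

/-- The matrix `M_φ` of the action of `φ ∈ Mod_g` on `H₁ ≅ ℤ^{2g}` with respect to the generators
`S`: its entries are the exponent sums `♯_s(φ(t))`, where the row index `s` and the column index
`t` run through `a₁,…,a_g,b₁,…,b_g`. -/
def homologyMatrix (φ : MappingClassGroup g) : Matrix (Fin g ⊕ Fin g) (Fin g ⊕ Fin g) ℤ :=
  Matrix.of fun s t => S.coord (H1Action g φ (Abelianization.of (S.gen t))) s

theorem homologyMatrix_outerClass (f : autPlus g) (s t : Fin g ⊕ Fin g) :
    S.homologyMatrix (outerClass f) s t = S.expSum s (f.1 (S.gen t)) := rfl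

end SymplecticGenerators

end SurfaceGroup

end

/-!
The exponent sum of `b_i` factors through `α`: it is the composite of `α` with the exponent sum of
`γ_i` on the free group, which is conjugation invariant. An automorphism that commutes with `α` up
to conjugation therefore preserves the exponent sums of all `b_i` (`expSumHom_inr_apply_eq`), and
this fixes the two lower blocks of `M_φ`: they are `0` and the identity.

The upper left block is found from the orientation. An automorphism that is trivial on `H₂`
preserves the intersection form on `H₁`. To see this without computing `H₂`, take two homomorphisms
`σ, τ : π_g → ℤ`. The bilinear map `(x, y) ↦ σ x * τ y` is a 2-cocycle, so it defines a functional
`cupPairing σ τ` on bar 2-chains that vanishes on boundaries. Hence its value on a cycle `z` is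
unchanged when `σ` and `τ` are precomposed with an automorphism acting trivially on `H₂`
(`cupPairing_comp_eq_of_map_eq_id`). The relation `∏ [a_i, b_i] = 1` provides an explicit cycle
`z`, the fundamental class, on which the functional takes the value
`∑ i, (σ a_i * τ b_i - σ b_i * τ a_i)` (`exists_chain_prod_commutator`). So this intersection
number is an invariant (`sum_intersection_eq`). For `σ = ♯_{a_j} ∘ f` and `τ = ♯_{b_k} ∘ f = ♯_{b_k}`
it reads `♯_{a_j}(f(a_k)) = δ_{jk}`.

The matrix is thus block unitriangular, and the eigenvalue, multiplicity and determinant are those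
of the identity.
-/

noncomputable section

/-! ### Cup products evaluated on bar 2-chains -/

section CupProduct

open groupHomology CategoryTheory Finsupp

variable {G : Type} [Group G]

/-- The functional on inhomogeneous 2-chains that evaluates the bilinear 2-cocycle
`(x, y) ↦ σ x * τ y`, which represents the cup product of the classes `σ, τ ∈ H¹(G; ℤ)`. -/
def cupPairing (σ τ : G →* Multiplicative ℤ) : (G × G →₀ ℤ) →ₗ[ℤ] ℤ :=
  Finsupp.linearCombination ℤ fun p : G × G => (σ p.1).toAdd * (τ p.2).toAdd

theorem cupPairing_single (σ τ : G →* Multiplicative ℤ) (p : G × G) (n : ℤ) :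
    cupPairing σ τ (single p n) = n * ((σ p.1).toAdd * (τ p.2).toAdd) := by
  simp [cupPairing]

/-- The cocycle identity for `(x, y) ↦ σ x * τ y`. -/
theorem cupPairing_d₃₂ (σ τ : G →* Multiplicative ℤ) (c : G × G × G →₀ ℤ) :
    cupPairing σ τ (d₃₂ (Rep.trivial ℤ G ℤ) c) = 0 := by
  have h : (cupPairing σ τ).comp (d₃₂ (Rep.trivial ℤ G ℤ)).hom = 0 := by
    refine Finsupp.lhom_ext fun p n => ?_
    refine (congrArg (cupPairing σ τ) (d₃₂_single (A := Rep.trivial ℤ G ℤ) p n)).trans ?_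
    change cupPairing σ τ (single (p.2.1, p.2.2) n - single (p.1 * p.2.1, p.2.2) n +
      single (p.1, p.2.1 * p.2.2) n - single (p.1, p.2.1) n) = 0
    simp only [map_sub, map_add, cupPairing_single, map_mul, toAdd_mul]
    ring
  exact LinearMap.congr_fun h c

theorem cupPairing_chainsMap₂ (f : G →* G) (σ τ : G →* Multiplicative ℤ) (c : G × G →₀ ℤ) :
    cupPairing σ τ (chainsMap₂ (A := Rep.trivial ℤ G ℤ) (B := Rep.trivial ℤ G ℤ) f
      (𝟙 (Rep.trivial ℤ G ℤ)) c) = cupPairing (σ.comp f) (τ.comp f) c := by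
  have h : (cupPairing σ τ).comp (chainsMap₂ (A := Rep.trivial ℤ G ℤ) (B := Rep.trivial ℤ G ℤ) f
      (𝟙 (Rep.trivial ℤ G ℤ))).hom = cupPairing (σ.comp f) (τ.comp f) := by
    refine Finsupp.lhom_ext fun p n => ?_
    change cupPairing σ τ (mapRange id rfl (mapDomain (Prod.map f f) (single p n))) = _
    rw [mapDomain_single, mapRange_single, cupPairing_single, cupPairing_single]
    rfl
  exact LinearMap.congr_fun h c

/-- The differential from 2-chains to 1-chains with trivial integer coefficients, as a linear map
between the free abelian groups on `G × G` and on `G`. -/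
def barBoundary (G : Type) [Group G] : (G × G →₀ ℤ) →ₗ[ℤ] (G →₀ ℤ) :=
  (d₂₁ (Rep.trivial ℤ G ℤ)).hom

theorem barBoundary_single (x y : G) (n : ℤ) :
    barBoundary G (single (x, y) n) = single y n - single (x * y) n + single x n :=
  d₂₁_single (A := Rep.trivial ℤ G ℤ) (x, y) n

theorem H2π_mapCycles₂_of_map_eq_id {A : Rep ℤ G} {f : G →* G} {φ : A ⟶ Rep.res f A}
    (h : groupHomology.map f φ 2 = 𝟙 _) (z : cycles₂ A) :
    H2π A (mapCycles₂ f φ z) = H2π A z := by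
  have h' := H2π_comp_map f φ
  rw [h] at h'
  replace h' := h'.symm.trans (Category.comp_id _)
  have h'' := ConcreteCategory.congr_hom h' z
  exact h''

/-- An endomorphism that is trivial on second homology moves a cycle by a boundary. -/
theorem exists_d₃₂_eq_chainsMap₂_sub {A : Rep ℤ G} {f : G →* G} {φ : A ⟶ Rep.res f A}
    (h : groupHomology.map f φ 2 = 𝟙 _) (z : cycles₂ A) :
    ∃ w, d₃₂ A w = chainsMap₂ f φ z.1 - z.1 := by
  have h₁ : (mapCycles₂ f φ z).1 - z.1 ∈ boundaries₂ A :=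
    (H2π_eq_iff (mapCycles₂ f φ z) z).mp (H2π_mapCycles₂_of_map_eq_id h z)
  have h₂ : ((mapCycles₂ f φ z).1 : G × G →₀ A) = chainsMap₂ f φ z.1 := coe_mapCycles₂ f φ z
  rw [h₂] at h₁
  exact h₁

/-- A cup product evaluated on a cycle does not change under an endomorphism that acts trivially
on second homology. The coefficient map is a variable equal to the identity because its codomain is
the restriction of the trivial representation along `f`. -/
theorem cupPairing_comp_eq_of_map_eq_id {f : G →* G}
    {φ : Rep.trivial ℤ G ℤ ⟶ Rep.res f (Rep.trivial ℤ G ℤ)}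
    (hφ : φ = 𝟙 (Rep.trivial ℤ G ℤ)) (hf : groupHomology.map f φ 2 = 𝟙 _)
    (σ τ : G →* Multiplicative ℤ) {z : G × G →₀ ℤ} (hz : barBoundary G z = 0) :
    cupPairing (σ.comp f) (τ.comp f) z = cupPairing σ τ z := by
  have hz' : z ∈ cycles₂ (Rep.trivial ℤ G ℤ) := LinearMap.mem_ker.mpr hz
  obtain ⟨w, hw⟩ := exists_d₃₂_eq_chainsMap₂_sub hf ⟨z, hz'⟩
  subst hφ
  have h := (congrArg (cupPairing σ τ) hw).symm.trans (cupPairing_d₃₂ σ τ w)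
  rw [← cupPairing_chainsMap₂, ← sub_eq_zero]
  exact (map_sub (cupPairing σ τ) _ _).symm.trans h

/-- The chain is the bar triangulation of a torus with one boundary circle `[x, y]`. -/
theorem exists_chain_commutator (x y : G) :
    ∃ c : G × G →₀ ℤ,
      barBoundary G c = single 1 1 - single (x * y * x⁻¹ * y⁻¹) 1 ∧
      ∀ σ τ : G →* Multiplicative ℤ, cupPairing σ τ c =
        (σ x).toAdd * (τ y).toAdd - (σ y).toAdd * (τ x).toAdd := by
  -- The first three simplices read off the word `x y x⁻¹ y⁻¹`, the next two cancel the edges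
  -- `x, x⁻¹` and `y, y⁻¹`, and the last one removes a surplus degenerate edge.
  refine ⟨single (x, y) 1 + single (x * y, x⁻¹) 1 + single (x * y * x⁻¹, y⁻¹) 1
    - single (x, x⁻¹) 1 - single (y, y⁻¹) 1 - single (1, 1) 1, ?_, fun σ τ => ?_⟩
  · simp only [map_sub, map_add, barBoundary_single, mul_inv_cancel, mul_one]
    abel
  · simp only [map_sub, map_add, cupPairing_single, map_mul, toAdd_mul, map_inv, toAdd_inv, map_one,
      toAdd_one]
    ring

/-- A product of commutators bounds a surface with one boundary circle, on which cup products take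
the value of the standard symplectic form. -/
theorem exists_chain_prod_commutator (l : List (G × G)) :
    ∃ c : G × G →₀ ℤ,
      barBoundary G c =
        single 1 1 - single (l.map fun p => p.1 * p.2 * p.1⁻¹ * p.2⁻¹).prod 1 ∧
      ∀ σ τ : G →* Multiplicative ℤ, cupPairing σ τ c =
        (l.map fun p =>
          (σ p.1).toAdd * (τ p.2).toAdd - (σ p.2).toAdd * (τ p.1).toAdd).sum := by
  induction l with
  | nil => exact ⟨0, by simp, by simp⟩
  | cons p l ih =>
    obtain ⟨c, hc, hc'⟩ := ih
    obtain ⟨d, hd, hd'⟩ := exists_chain_commutator p.1 p.2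
    -- The simplex `(u, v)` with edges `u`, `v`, `u * v` glues the two surfaces; it does not
    -- contribute to cup products because `u` is a commutator.
    refine ⟨d + c + single (p.1 * p.2 * p.1⁻¹ * p.2⁻¹,
      (l.map fun p => p.1 * p.2 * p.1⁻¹ * p.2⁻¹).prod) 1 - single (1, 1) 1, ?_, fun σ τ => ?_⟩
    · simp only [map_sub, map_add, barBoundary_single, hc, hd, mul_one, List.map_cons,
        List.prod_cons]
      abel
    · have hu : (σ (p.1 * p.2 * p.1⁻¹ * p.2⁻¹)).toAdd = 0 := by
        simp only [map_mul, map_inv, toAdd_mul, toAdd_inv]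
        ring
      simp only [map_sub, map_add, cupPairing_single, hc', hd', hu, map_one, toAdd_one,
        List.map_cons, List.sum_cons]
      ring

end CupProduct

/-! ### Invariance of the intersection form -/

namespace SurfaceGroup.SymplecticGenerators

variable {g : ℕ} (S : SymplecticGenerators g)

theorem prod_commutator_eq_one :
    ((List.ofFn fun i => (S.a i, S.b i)).map fun p => p.1 * p.2 * p.1⁻¹ * p.2⁻¹).prod = 1 := by
  have h : ((List.ofFn fun i => (S.a i, S.b i)).map fun p => p.1 * p.2 * p.1⁻¹ * p.2⁻¹).prod =
      FreeGroup.lift S.gen (surfaceRelator g) := by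
    simp [surfaceRelator, map_list_prod, List.map_ofFn, Function.comp_def, a, b]
  exact h.trans (S.relation _ (Set.mem_singleton _))

/-- The intersection form on `H¹` is invariant under `Aut⁺(π_g)`: both sides are the value of the
cup product of two classes on the fundamental class. -/
theorem sum_intersection_eq (f : autPlus g) (σ τ : SurfaceGroup g →* Multiplicative ℤ) :
    ∑ i, ((σ (f.1 (S.a i))).toAdd * (τ (f.1 (S.b i))).toAdd -
        (σ (f.1 (S.b i))).toAdd * (τ (f.1 (S.a i))).toAdd) =
      ∑ i, ((σ (S.a i)).toAdd * (τ (S.b i)).toAdd - (σ (S.b i)).toAdd * (τ (S.a i)).toAdd) := by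
  obtain ⟨z, hz, hz'⟩ := exists_chain_prod_commutator (List.ofFn fun i => (S.a i, S.b i))
  rw [prod_commutator_eq_one, sub_self] at hz
  have h := cupPairing_comp_eq_of_map_eq_id (f := f.1.toMonoidHom) rfl f.2 σ τ hz
  rw [hz', hz', List.map_ofFn, List.map_ofFn, List.sum_ofFn, List.sum_ofFn] at h
  exact h

/-! ### Exponent sums of an automorphism compatible with `α` -/

theorem hom_ext {H : Type*} [Group H] {φ ψ : SurfaceGroup g →* H}
    (h : ∀ s, φ (S.gen s) = ψ (S.gen s)) : φ = ψ := by
  have h' : φ.comp S.ofStandard.toMonoidHom = ψ.comp S.ofStandard.toMonoidHom := by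
    refine PresentedGroup.ext fun s => ?_
    simpa [S.ofStandard_of] using h s
  refine MonoidHom.ext fun x => ?_
  simpa using DFunLike.congr_fun h' (S.ofStandard.symm x)

variable {γ : FreeGroupBasis (Fin g) (FreeGroup (Fin g))} {α : SurfaceGroup g →* FreeGroup (Fin g)}

/-- The exponent sum of `b_i` is the exponent sum of `γ_i` composed with `α`. -/
theorem expSumHom_inr_eq_lift_comp (hαa : ∀ i, α (S.a i) = 1) (hαb : ∀ i, α (S.b i) = γ i)
    (i : Fin g) :
    S.expSumHom (Sum.inr i) =
      (γ.lift fun j => Multiplicative.ofAdd (if i = j then (1 : ℤ) else 0)).comp α := by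
  refine S.hom_ext fun s => ?_
  rw [S.expSumHom_gen]
  rcases s with j | j
  · have := hαa j
    rw [a] at this
    simp [this]
  · have := hαb j
    rw [b] at this
    simp [this]

theorem expSumHom_inr_apply_eq (hαa : ∀ i, α (S.a i) = 1) (hαb : ∀ i, α (S.b i) = γ i)
    {f : SurfaceGroup g → SurfaceGroup g} {c : FreeGroup (Fin g)}
    (hf : ∀ x, α (f x) = c * α x * c⁻¹) (i : Fin g) (x : SurfaceGroup g) :
    S.expSumHom (Sum.inr i) (f x) = S.expSumHom (Sum.inr i) x := by
  simp [S.expSumHom_inr_eq_lift_comp hαa hαb, hf, mul_inv_cancel_comm]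

/-- Since `f` preserves the exponent sums of `b_k`, the invariance of the intersection number of
`♯_{a_j}` and `♯_{b_k}` leaves only the term `♯_{a_j}(f(a_k))` on one side and `δ_{jk}` on the
other. -/
theorem expSumA_apply_a (hαa : ∀ i, α (S.a i) = 1) (hαb : ∀ i, α (S.b i) = γ i)
    (f : autPlus g) {c : FreeGroup (Fin g)}
    (hf : ∀ x, α (f.1 x) = c * α x * c⁻¹) (j k : Fin g) :
    S.expSumA j (f.1 (S.a k)) = if j = k then 1 else 0 := by
  have h := S.sum_intersection_eq f (S.expSumHom (Sum.inl j)) (S.expSumHom (Sum.inr k))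
  simp only [S.expSumHom_inr_apply_eq hαa hαb hf] at h
  simp only [a, b, S.expSumHom_gen, toAdd_ofAdd, Sum.inr.injEq, Sum.inl.injEq, reduceCtorEq,
    if_false, mul_zero, sub_zero, mul_ite, mul_one, Finset.sum_ite_eq, Finset.mem_univ, if_true] at h
  exact h

/-! ### The matrix of the action on `H₁` -/

theorem homologyMatrix_eq_fromBlocks (hαa : ∀ i, α (S.a i) = 1) (hαb : ∀ i, α (S.b i) = γ i)
    {φ : MappingClassGroup g} (hφ : φ ∈ modSubgroup α) :
    ∃ A : Matrix (Fin g) (Fin g) ℤ, S.homologyMatrix φ = Matrix.fromBlocks 1 A 0 1 := by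
  obtain ⟨f, rfl, c, hf⟩ := hφ
  refine ⟨(S.homologyMatrix (outerClass f)).toBlocks₁₂, ?_⟩
  ext (i | i) (j | j)
  · exact (S.expSumA_apply_a hαa hαb f hf i j).trans (Matrix.one_apply).symm
  · rfl
  · rw [homologyMatrix_outerClass, expSum, S.expSumHom_inr_apply_eq hαa hαb hf]
    simp [S.expSumHom_gen]
  · rw [homologyMatrix_outerClass, expSum, S.expSumHom_inr_apply_eq hαa hαb hf]
    simp [S.expSumHom_gen, Matrix.one_apply]

theorem coord_H1Action (φ : MappingClassGroup g) (x : H1 g) :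
    S.coord (H1Action g φ x) = (S.homologyMatrix φ).mulVec (S.coord x) := by
  let L : H1 g →* Multiplicative (Fin g ⊕ Fin g → ℤ) :=
    S.H1Equiv.toMonoidHom.comp (H1Action g φ).toMonoidHom
  let R : H1 g →* Multiplicative (Fin g ⊕ Fin g → ℤ) :=
    (AddMonoidHom.toMultiplicative (S.homologyMatrix φ).mulVecLin.toAddMonoidHom).comp
      S.H1Equiv.toMonoidHom
  have key : L = R := by
    refine Abelianization.hom_ext _ _ (S.hom_ext fun t => ?_)
    apply Multiplicative.toAdd.injective
    have ht : S.coord (Abelianization.of (S.gen t)) = Pi.single t 1 := by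
      ext s
      change S.expSum s (S.gen t) = _
      simp [expSum, S.expSumHom_gen, Pi.single_apply]
    change S.coord (H1Action g φ (Abelianization.of (S.gen t))) =
      (S.homologyMatrix φ).mulVec (S.coord (Abelianization.of (S.gen t)))
    rw [ht, Matrix.mulVec_single_one]
    rfl
  exact congrArg Multiplicative.toAdd (DFunLike.congr_fun key x)

end SurfaceGroup.SymplecticGenerators

theorem Matrix.charpoly_fromBlocks_one_zero_one {R m n : Type*} [CommRing R] [Fintype m]
    [Fintype n] [DecidableEq m] [DecidableEq n] (A : Matrix m n R) :
    (Matrix.fromBlocks 1 A 0 1).charpoly =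
      (Polynomial.X - 1) ^ (Fintype.card m + Fintype.card n) := by
  rw [Matrix.charpoly_fromBlocks_zero₂₁, Matrix.charpoly_one, Matrix.charpoly_one, pow_add]

theorem mainTheorem9 (g : ℕ) (hg : 1 ≤ g)
    (S : SurfaceGroup.SymplecticGenerators g)
    (γ : FreeGroupBasis (Fin g) (FreeGroup (Fin g)))
    (α : SurfaceGroup g →* FreeGroup (Fin g))
    (hαa : ∀ i, α (S.a i) = 1) (hαb : ∀ i, α (S.b i) = γ i)
    (φ : SurfaceGroup.MappingClassGroup g) (hφ : φ ∈ SurfaceGroup.modSubgroup α) :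
    (∀ f : SurfaceGroup.autPlus g, SurfaceGroup.outerClass f = φ → ∀ i j : Fin g,
      S.expSumB i (f.1 (S.b j)) = (if i = j then 1 else 0) ∧
      S.expSumB i (f.1 (S.a j)) = 0 ∧
      S.expSumA j (f.1 (S.a i)) = (if i = j then 1 else 0)) ∧
    (∀ x : SurfaceGroup.H1 g,
      S.coord (SurfaceGroup.H1Action g φ x) = (S.homologyMatrix φ).mulVec (S.coord x)) ∧
    (∃ A : Matrix (Fin g) (Fin g) ℤ, S.homologyMatrix φ = Matrix.fromBlocks 1 A 0 1) ∧
    (∀ μ : ℂ, Module.End.HasEigenvalue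
      (Matrix.toLin' ((S.homologyMatrix φ).map (Int.cast : ℤ → ℂ))) μ ↔ μ = 1) ∧
    Polynomial.rootMultiplicity 1
      ((S.homologyMatrix φ).map (Int.cast : ℤ → ℂ)).charpoly = 2 * g ∧
    (S.homologyMatrix φ).det = 1 := by
  obtain ⟨A, hA⟩ := S.homologyMatrix_eq_fromBlocks hαa hαb hφ
  have hmap : (S.homologyMatrix φ).map (Int.cast : ℤ → ℂ) =
      Matrix.fromBlocks 1 (A.map Int.cast) 0 1 := by
    rw [hA, Matrix.fromBlocks_map]
    simp [Matrix.map_one, Matrix.map_zero]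
  have hchar : ((S.homologyMatrix φ).map (Int.cast : ℤ → ℂ)).charpoly =
      (Polynomial.X - Polynomial.C 1) ^ (2 * g) := by
    rw [hmap, Matrix.charpoly_fromBlocks_one_zero_one, Fintype.card_fin, two_mul, map_one]
  refine ⟨?_, S.coord_H1Action φ, ⟨A, hA⟩, fun μ => ?_, ?_, ?_⟩
  · rintro f rfl i j
    refine ⟨?_, ?_, ?_⟩
    · exact (congrFun₂ hA (Sum.inr i) (Sum.inr j)).trans Matrix.one_apply
    · exact congrFun₂ hA (Sum.inr i) (Sum.inl j)
    · refine (congrFun₂ hA (Sum.inl j) (Sum.inl i)).trans ?_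
      simp [Matrix.one_apply, eq_comm]
  · rw [Module.End.hasEigenvalue_iff_isRoot_charpoly, Matrix.charpoly_toLin', hchar,
      Polynomial.IsRoot.def, Polynomial.eval_pow, pow_eq_zero_iff (by lia)]
    simp [sub_eq_zero]
  · rw [hchar, Polynomial.rootMultiplicity_X_sub_C_pow]
  · rw [hA, Matrix.det_fromBlocks_zero₂₁, Matrix.det_one, mul_one]

end
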